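/- Let $\alpha\in 2\pi(\mathbb R\setminus\mathbb Q)$, let $X=S^1=\mathbb R/2\pi\mathbb Z$, $Tx=x+\alpha$ on $X$ and $\tau t=t+\alpha$ on $S^1$. Let $\mathcal C=C(X)\rtimes_r\mathbb Z$, realized on $L^2(X)$ (with normalized Lebesgue measure) as the $C^*$-algebra generated by the multiplication operators $M_f$, $f\in C(X)$, and the Koopman operator $\lambda_1 v=v\circ T$. Let $C^*_r(\mathbb Z)\subset\mathcal C$ be the $C^*$-algebra generated by $\lambda_1$, identified with $C(S^1)$ by the $*$-isomorphism $\phi\mapsto\hat\phi$ that takes $e^{it}$ to $\lambda_1$. For a closed ideal $I\lhd C^*_r(\mathbb Z)$ let $Z(I)=\{t\in S^1:\phi(t)=0 \text{ whenever } \hat\phi\in I\}$. Ideals are closed and two-sided. An ideal function is a map $\mathfrak c$ from $\mathbb Z$ to the ideals of $C^*_r(\mathbb Z)$ with $\mathfrak c(0)=C^*_r(\mathbb Z)$; put $\operatorname{Supp}(\mathfrak c)=\{n:\mathfrak c(n)\neq(0)\}$. It is closed if for all $n\in\mathbb Z$, $Z(\mathfrak c(-n))=\tau^nZ(\mathfrak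 c(n))$, and for all $m,n\in\operatorname{Supp}(\mathfrak c)$, $Z(\mathfrak c(m+n))\subset\tau^{-m}Z(\mathfrak c(n))\cup Z(\mathfrak c(m))$. Fix a closed ideal function $\mathfrak c$ and let $\mathcal A=\Phi(\mathfrak c)\subset\mathcal C$ be the $C^*$-algebra generated by all $e^{inx}\eta$ with $n\in\mathbb Z$, $\eta\in\mathfrak c(n)$; it contains $C^*_r(\mathbb Z)$. Let $\mathfrak I_{\mathcal A}$ be the lattice of closed two-sided ideals of $\mathcal A$ (meet: intersection; join: closure of the sum). Let $\mathfrak D_{\mathfrak c}$ be the lattice of $\mathfrak c$-ideal functions, that is, of maps $\mathfrak j$ from $\mathbb Z$ to the ideals of $C^*_r(\mathbb Z)$ with $\mathfrak j(n)\subset\mathfrak c(n)$ for all $n$, with pointwise order, meet $\wedge$ (intersection) and join $\overline\vee$ (closure of the sum). Call $\mathfrak j\in\mathfrak D_{\mathfrak c}$ closed if - $\mathtt{Cif}1(\mathfrak c)$: $Z(\mathfrak j(-n))=\tau^nZ(\mathfrak j(n))$ for all $n\in\mathbb Z$, and - $\mathtt{Cif}2(\mathfrak c)$: $Z(\mathfrak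 j(m+n))\subset\tau^{-m}Z(\mathfrak c(n))\cup Z(\mathfrak j(m))$ for all $n\in\operatorname{Supp}(\mathfrak c)$, $m\in\operatorname{Supp}(\mathfrak j)$, and let $\mathfrak C_{\mathfrak c}$ be the set of closed $\mathfrak c$-ideal functions. For $\mathfrak j\in\mathfrak D_{\mathfrak c}$ let $\Phi_{\mathfrak c}(\mathfrak j)$ be the closed two-sided ideal of $\mathcal A$ generated by all $e^{inx}\eta$ with $n\in\mathbb Z$, $\eta\in\mathfrak j(n)$, and for $J\in\mathfrak I_{\mathcal A}$ let $\Psi_{\mathcal A}(J)(n)=\{\eta\in C^*_r(\mathbb Z): e^{inx}\eta\in J\}$. Theorem. $\Psi_{\mathcal A}$ maps $\mathfrak I_{\mathcal A}$ into $\mathfrak D_{\mathfrak c}$, and: 1. $\Phi_{\mathfrak c}:\mathfrak D_{\mathfrak c}\to\mathfrak I_{\mathcal A}$ and $\Psi_{\mathcal A}:\mathfrak I_{\mathcal A}\to\mathfrak D_{\mathfrak c}$ form a monotone Galois connection: $\Phi_{\mathfrak c}(\mathfrak j)\subset J$ if and only if $\mathfrak j\le\Psi_{\mathcal A}(J)$.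 2. It is perfect at $\mathfrak I_{\mathcal A}$: $\Phi_{\mathfrak c}(\Psi_{\mathcal A}(J))=J$ for every $J\in\mathfrak I_{\mathcal A}$. 3. For $\mathfrak j\in\mathfrak D_{\mathfrak c}$, $\mathfrak j=\Psi_{\mathcal A}(\Phi_{\mathfrak c}(\mathfrak j))$ if and only if $\mathfrak j$ is closed. 4. $\mathfrak C_{\mathfrak c}$ is stable under the meet $\wedge$ and under the closed join $\mathfrak j_1\vee\mathfrak j_2:=\Psi_{\mathcal A}\Phi_{\mathfrak c}(\mathfrak j_1\overline\vee\mathfrak j_2)$, and with these operations $\Phi_{\mathfrak c}$ restricts to an isomorphism of lattices $\mathfrak C_{\mathfrak c}\to\mathfrak I_{\mathcal A}$ with inverse $\Psi_{\mathcal A}$. -/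

import Mathlib

open scoped Real ENNReal
open MeasureTheory

namespace RotationAlgebra

noncomputable section

/-! ### Closed two-sided ideals of a topological ring -/

/-- The closed two-sided ideals of a topological ring. -/
@[ext]
structure ClosedIdeal (R : Type*) [Ring R] [TopologicalSpace R] where
  /-- the underlying two-sided ideal -/
  ideal : TwoSidedIdeal R
  isClosed : IsClosed (ideal : Set R)

/-- Closed ideals are ordered by inclusion. -/
instance {R : Type*} [Ring R] [TopologicalSpace R] : PartialOrder (ClosedIdeal R) :=
  PartialOrder.lift ClosedIdeal.ideal fun _ _ h => ClosedIdeal.ext h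

theorem ClosedIdeal.le_def {R : Type*} [Ring R] [TopologicalSpace R] {I J : ClosedIdeal R} :
    I ≤ J ↔ I.ideal ≤ J.ideal := Iff.rfl

/-- The topological closure of a two-sided ideal, as a closed two-sided ideal. -/
def idealClosure {R : Type*} [Ring R] [TopologicalSpace R] [IsTopologicalRing R]
    (I : TwoSidedIdeal R) : ClosedIdeal R where
  ideal := TwoSidedIdeal.mk' (closure (I : Set R))
    (subset_closure I.zero_mem)
    (fun hx hy => map_mem_closure₂ continuous_add hx hy fun _ ha _ hb => I.add_mem ha hb)
    (fun hx => map_mem_closure continuous_neg hx fun _ ha => I.neg_mem ha)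
    (fun {x _} hy =>
      map_mem_closure (continuous_const_mul x) hy fun _ ha => I.mul_mem_left x _ ha)
    (fun {_ y} hx => map_mem_closure (f := fun z => z * y)
      (continuous_mul_const y) hx fun _ ha => I.mul_mem_right _ y ha)
  isClosed := by rw [TwoSidedIdeal.coe_mk']; exact isClosed_closure

theorem coe_idealClosure {R : Type*} [Ring R] [TopologicalSpace R] [IsTopologicalRing R]
    (I : TwoSidedIdeal R) : ((idealClosure I).ideal : Set R) = closure (I : Set R) := by
  rw [idealClosure, TwoSidedIdeal.coe_mk']

theorem idealClosure_le_iff {R : Type*} [Ring R] [TopologicalSpace R] [IsTopologicalRing R]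
    {I : TwoSidedIdeal R} {J : ClosedIdeal R} : idealClosure I ≤ J ↔ I ≤ J.ideal := by
  rw [ClosedIdeal.le_def, TwoSidedIdeal.le_iff, TwoSidedIdeal.le_iff, coe_idealClosure]
  exact J.isClosed.closure_subset_iff

/-- The lattice of closed two-sided ideals: the meet is the intersection, the join is the
closure of the sum. -/
instance {R : Type*} [Ring R] [TopologicalSpace R] [IsTopologicalRing R] :
    Lattice (ClosedIdeal R) :=
  { (inferInstance : PartialOrder (ClosedIdeal R)) with
    inf := fun I J => ⟨I.ideal ⊓ J.ideal, by
      have h : ((I.ideal ⊓ J.ideal : TwoSidedIdeal R) : Set R) =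
          (I.ideal : Set R) ∩ (J.ideal : Set R) := by
        ext x; exact TwoSidedIdeal.mem_inf R
      rw [h]; exact I.isClosed.inter J.isClosed⟩
    inf_le_left := fun I J => (inf_le_left : I.ideal ⊓ J.ideal ≤ I.ideal)
    inf_le_right := fun I J => (inf_le_right : I.ideal ⊓ J.ideal ≤ J.ideal)
    le_inf := fun I J K hJ hK => (le_inf hJ hK : I.ideal ≤ J.ideal ⊓ K.ideal)
    sup := fun I J => idealClosure (I.ideal ⊔ J.ideal)
    le_sup_left := fun I J =>
      (le_sup_left : I.ideal ≤ I.ideal ⊔ J.ideal).trans (idealClosure_le_iff.1 le_rfl)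
    le_sup_right := fun I J =>
      (le_sup_right : J.ideal ≤ I.ideal ⊔ J.ideal).trans (idealClosure_le_iff.1 le_rfl)
    sup_le := fun I J K hI hJ =>
      idealClosure_le_iff.2 (sup_le hI hJ : I.ideal ⊔ J.ideal ≤ K.ideal) }

/-! ### The rotation, the crossed product and the group algebra -/

instance fact_two_pi_pos : Fact (0 < 2 * π) := ⟨Real.two_pi_pos⟩

/-- The circle `ℝ / 2πℤ`.  It plays two roles: the phase space `X`, and the dual `S¹` of `ℤ`. -/
abbrev Circ : Type := AddCircle (2 * π)

/-- The Hilbert space `L²(X, μ)`, with `μ` the normalized Lebesgue measure. -/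
abbrev HX : Type := Lp ℂ 2 (AddCircle.haarAddCircle : Measure Circ)

/-- Bounded operators on `L²(X, μ)`. -/
abbrev BH : Type := HX →L[ℂ] HX

/-- The multiplication operator `v ↦ f v` on `L²(X, μ)`, for continuous `f`. -/
def mulOp (f : C(Circ, ℂ)) : BH :=
  (ContinuousLinearMap.mul ℂ ℂ).holderL AddCircle.haarAddCircle ∞ 2 2
    (ContinuousMap.toLp ∞ AddCircle.haarAddCircle ℂ f)

theorem coeFn_mulOp (f : C(Circ, ℂ)) (v : HX) :
    mulOp f v =ᵐ[AddCircle.haarAddCircle] fun x => f x * v x := by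
  have h1 := (ContinuousLinearMap.mul ℂ ℂ).coeFn_holder (r := 2)
    (ContinuousMap.toLp ∞ (AddCircle.haarAddCircle : Measure Circ) ℂ f) v
  have h2 := ContinuousMap.coeFn_toLp (p := ∞) (𝕜 := ℂ)
    (AddCircle.haarAddCircle : Measure Circ) f
  filter_upwards [h1, h2] with x hx1 hx2
  rw [show mulOp f v x = _ from hx1, hx2]
  rfl

instance isTopologicalRing_starSubalgebra (A : StarSubalgebra ℂ BH) : IsTopologicalRing A :=
  inferInstanceAs (IsTopologicalRing A.toSubalgebra.toSubring)

/-- The function `e^{inx}`, as a multiplication operator. -/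
def expX (n : ℤ) : BH := mulOp (fourier n)

/-- The Koopman operator `v ↦ v ∘ T` of `T x = x + α`, as a linear isometry. -/
def koopmanIsometry (α : ℝ) : HX →ₗᵢ[ℂ] HX :=
  Lp.compMeasurePreservingₗᵢ ℂ (fun x : Circ => x + (α : Circ))
    (measurePreserving_add_right AddCircle.haarAddCircle (α : Circ))

/-- The generator `λ₁`: the Koopman operator of the rotation by `α`. -/
def koopman (α : ℝ) : BH := (koopmanIsometry α).toContinuousLinearMap

theorem koopman_mul_koopman_neg (α : ℝ) : koopman α * koopman (-α) = 1 := by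
  ext1 v
  apply Lp.ext
  have hm := measurePreserving_add_right (AddCircle.haarAddCircle : Measure Circ) (α : Circ)
  have hm' := measurePreserving_add_right (AddCircle.haarAddCircle : Measure Circ)
    ((-α : ℝ) : Circ)
  have h1 := Lp.coeFn_compMeasurePreserving (koopman (-α) v) hm
  have h2 := hm.quasiMeasurePreserving.ae (Lp.coeFn_compMeasurePreserving v hm')
  filter_upwards [h1, h2] with x hx1 hx2
  refine Eq.trans hx1 (Eq.trans hx2 ?_)
  simp

theorem koopman_mem_unitary (α : ℝ) : koopman α ∈ unitary BH := by
  have hs : star (koopman α) * koopman α = 1 := by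
    ext1 v
    refine ext_inner_left ℂ fun w => ?_
    change inner ℂ w (ContinuousLinearMap.adjoint (koopman α) (koopman α v)) = inner ℂ w v
    rw [ContinuousLinearMap.adjoint_inner_right]
    exact (koopmanIsometry α).inner_map_map w v
  have hinv : star (koopman α) = koopman (-α) := by
    calc star (koopman α) = star (koopman α) * (koopman α * koopman (-α)) := by
          rw [koopman_mul_koopman_neg, mul_one]
      _ = koopman (-α) := by rw [← mul_assoc, hs, one_mul]
  exact Unitary.mem_iff.2 ⟨hs, by rw [hinv, koopman_mul_koopman_neg]⟩

instance koopman_isStarNormal (α : ℝ) : IsStarNormal (koopman α) :=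
  ⟨(Unitary.star_mul_self_of_mem (koopman_mem_unitary α)).trans
    (Unitary.mul_star_self_of_mem (koopman_mem_unitary α)).symm⟩

/-- The group algebra `C*_r(ℤ)`: the closed unital star subalgebra generated by `λ₁`. -/
abbrev CstarZ (α : ℝ) : StarSubalgebra ℂ BH := StarAlgebra.elemental ℂ (koopman α)

/-- The crossed product `C(X) ⋊_r ℤ`: the C*-algebra of operators on `L²(X, μ)` generated by
the multiplication operators by continuous functions and the Koopman operator. -/
def crossedProduct (α : ℝ) : StarSubalgebra ℂ BH :=
  (StarAlgebra.adjoin ℂ (Set.range mulOp ∪ {koopman α})).topologicalClosure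

/-! ### The identification `C(S¹) ≅ C*_r(ℤ)` -/

/-- The spectrum of the unitary `λ₁`, as part of the circle: the inverse of `t ↦ e^{it}`. -/
def spectrumToCirc (α : ℝ) : C(spectrum ℂ (koopman α), Circ) where
  toFun z := AddCircle.homeomorphCircle'.symm
    ⟨z.1, spectrum.subset_circle_of_unitary (koopman_mem_unitary α) z.2⟩
  continuous_toFun := AddCircle.homeomorphCircle'.symm.continuous.comp
    (Continuous.subtype_mk continuous_subtype_val _)

/-- The map `φ ↦ φ̂` from `C(S¹)` to `C*_r(ℤ)`, which is the continuous functional calculus of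
`λ₁`: the star homomorphism that takes the function `e^{it}` to `λ₁`. -/
def hat (α : ℝ) : C(Circ, ℂ) →⋆ₐ[ℂ] CstarZ α :=
  ((continuousFunctionalCalculus (koopman α)) :
      C(spectrum ℂ (koopman α), ℂ) →⋆ₐ[ℂ] CstarZ α).comp
    (ContinuousMap.compStarAlgHom' ℂ ℂ (spectrumToCirc α))

theorem hat_fourier_one (α : ℝ) : (hat α (fourier 1) : BH) = koopman α := by
  have h := continuousFunctionalCalculus_map_id (koopman α)
  have h2 : ContinuousMap.compStarAlgHom' ℂ ℂ (spectrumToCirc α) (fourier 1) =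
      (ContinuousMap.id ℂ).restrict (spectrum ℂ (koopman α)) := by
    ext z
    have h3 : ((AddCircle.homeomorphCircle' (spectrumToCirc α z) : Circle) : ℂ) = z.1 := by
      change ((AddCircle.homeomorphCircle' (AddCircle.homeomorphCircle'.symm _) : Circle) : ℂ) = _
      exact congrArg _ (Homeomorph.apply_symm_apply _ _)
    change fourier 1 (spectrumToCirc α z) = z.1
    rw [← h3]
    generalize spectrumToCirc α z = t
    induction t using QuotientAddGroup.induction_on with
    | H x =>
      rw [fourier_one, AddCircle.toCircle_apply_mk, AddCircle.homeomorphCircle'_apply_mk]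
      congr 2
      field_simp
  change ((continuousFunctionalCalculus (koopman α)
    (ContinuousMap.compStarAlgHom' ℂ ℂ (spectrumToCirc α) (fourier 1)) : CstarZ α) : BH) = _
  rw [h2, h]

/-- The closed subset of `S¹` that corresponds to an ideal `I` of `C*_r(ℤ)`: the common zeros of
all `φ ∈ C(S¹)` with `φ̂ ∈ I`. -/
def zeroSet {α : ℝ} (I : ClosedIdeal (CstarZ α)) : Set Circ :=
  {t | ∀ φ : C(Circ, ℂ), hat α φ ∈ I.ideal → φ t = 0}

/-- The rotation `τ t = t + α` of `S¹`. -/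
def rot (α : ℝ) : Equiv.Perm Circ := Equiv.addRight (α : Circ)

/-! ### Ideal functions -/

/-- The support of a function from `ℤ` to the ideals of `C*_r(ℤ)`. -/
def Supp {α : ℝ} (j : ℤ → ClosedIdeal (CstarZ α)) : Set ℤ := {n | (j n).ideal ≠ ⊥}

/-- Ideal functions: functions `c` from `ℤ` to the closed ideals of `C*_r(ℤ)`, such that
`c 0 = C*_r(ℤ)`. -/
abbrev IdealFunction (α : ℝ) : Type := {c : ℤ → ClosedIdeal (CstarZ α) // (c 0).ideal = ⊤}

/-- `Cif1`: the set at `-n` is `τⁿ` applied to the set at `n`. -/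
def Cif1 {α : ℝ} (j : ℤ → ClosedIdeal (CstarZ α)) : Prop :=
  ∀ n : ℤ, zeroSet (j (-n)) = (rot α ^ n) '' zeroSet (j n)

/-- `Cif2(c)` for `j`.  The condition `Cif2` for `c` itself is the case `j = c`. -/
def Cif2 {α : ℝ} (c j : ℤ → ClosedIdeal (CstarZ α)) : Prop :=
  ∀ n ∈ Supp c, ∀ m ∈ Supp j,
    zeroSet (j (m + n)) ⊆ (rot α ^ (-m)) '' zeroSet (c n) ∪ zeroSet (j m)

/-- Closed ideal functions. -/
def IdealFunction.Closed {α : ℝ} (c : IdealFunction α) : Prop := Cif1 c.1 ∧ Cif2 c.1 c.1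

/-- The lattice `𝔇_c` of `c`-ideal functions, with the pointwise order: `j n ≤ c n` for all
`n`. -/
abbrev RelIdealFunction {α : ℝ} (c : IdealFunction α) : Type := Set.Iic c.1

instance {α : ℝ} (c : IdealFunction α) : Lattice (RelIdealFunction c) :=
  inferInstanceAs (Lattice (Set.Iic c.1))

/-- Closed `c`-ideal functions. -/
def RelIdealFunction.Closed {α : ℝ} {c : IdealFunction α} (j : RelIdealFunction c) : Prop :=
  Cif1 j.1 ∧ Cif2 c.1 j.1

/-! ### Intermediate algebras and their ideals -/

/-- Intermediate C*-algebras `C*_r(ℤ) ≤ A ≤ C(X) ⋊_r ℤ`. -/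
structure IntermediateAlgebra (α : ℝ) where
  /-- the underlying algebra of operators -/
  alg : StarSubalgebra ℂ BH
  isClosed : IsClosed (alg : Set BH)
  le_alg : CstarZ α ≤ alg
  alg_le : alg ≤ crossedProduct α

/-- The elements `e^{inx} η` with `n ∈ ℤ` and `η ∈ j n`. -/
def generators {α : ℝ} (j : ℤ → ClosedIdeal (CstarZ α)) : Set BH :=
  {a | ∃ n : ℤ, ∃ η : CstarZ α, η ∈ (j n).ideal ∧ a = expX n * (η : BH)}

theorem expX_zero : expX 0 = 1 := by
  ext1 v
  apply Lp.ext
  filter_upwards [coeFn_mulOp (fourier 0) v] with x hx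
  refine Eq.trans hx ?_
  simp

theorem cstarZ_le_crossedProduct (α : ℝ) : CstarZ α ≤ crossedProduct α :=
  StarAlgebra.elemental.le_of_mem (StarSubalgebra.isClosed_topologicalClosure _)
    (StarSubalgebra.le_topologicalClosure _ (StarAlgebra.subset_adjoin ℂ _ (Or.inr rfl)))

/-- `Φ(c)`, the C*-algebra generated by all `e^{inx} η` with `η ∈ c n`. -/
def Phi {α : ℝ} (c : IdealFunction α) : IntermediateAlgebra α where
  alg := (StarAlgebra.adjoin ℂ (generators c.1)).topologicalClosure
  isClosed := StarSubalgebra.isClosed_topologicalClosure _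
  le_alg := fun x hx => StarSubalgebra.le_topologicalClosure _
    (StarAlgebra.subset_adjoin ℂ _
      ⟨0, ⟨x, hx⟩, by rw [c.2]; trivial, by rw [expX_zero, one_mul]⟩)
  alg_le := by
    refine StarSubalgebra.topologicalClosure_minimal (StarAlgebra.adjoin_le ?_)
      (StarSubalgebra.isClosed_topologicalClosure _)
    rintro _ ⟨n, η, -, rfl⟩
    exact mul_mem (StarSubalgebra.le_topologicalClosure _
      (StarAlgebra.subset_adjoin ℂ _ (Or.inl ⟨_, rfl⟩))) (cstarZ_le_crossedProduct α η.2)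

/-- `Φ_c(j)`, the closed two-sided ideal of `Φ(c)` generated by all `e^{inx} η` with
`η ∈ j n`.  (These elements lie in `Φ(c)`, because `j n ≤ c n`.) -/
def PhiRel {α : ℝ} (c : IdealFunction α) (j : RelIdealFunction c) : ClosedIdeal (Phi c).alg :=
  idealClosure (TwoSidedIdeal.span {a : (Phi c).alg | (a : BH) ∈ generators j.1})

/-- `Ψ_A(J)`, whose value at `n` is the ideal of all `η ∈ C*_r(ℤ)` with `e^{inx} η ∈ J`. -/
def PsiRel {α : ℝ} (A : IntermediateAlgebra α) (J : ClosedIdeal A.alg) (n : ℤ) :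
    ClosedIdeal (CstarZ α) :=
  ⟨TwoSidedIdeal.mk' {η : CstarZ α | ∃ a ∈ J.ideal, (a : BH) = expX n * (η : BH)}
      ⟨0, J.ideal.zero_mem, by simp⟩
      (by
        rintro x y ⟨a, ha, hax⟩ ⟨b, hb, hby⟩
        exact ⟨a + b, J.ideal.add_mem ha hb, by simp [hax, hby, mul_add]⟩)
      (by
        rintro x ⟨a, ha, hax⟩
        exact ⟨-a, J.ideal.neg_mem ha, by simp [hax]⟩)
      (by
        rintro x y ⟨a, ha, hay⟩
        refine ⟨a * ⟨x, A.le_alg x.2⟩, J.ideal.mul_mem_right _ _ ha, ?_⟩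
        rw [mul_comm x y]
        simp [hay, mul_assoc])
      (by
        rintro x y ⟨a, ha, hax⟩
        exact ⟨a * ⟨y, A.le_alg y.2⟩, J.ideal.mul_mem_right _ _ ha, by simp [hax, mul_assoc]⟩),
    by
      rw [TwoSidedIdeal.coe_mk']
      have hJ : IsClosed ((fun a : A.alg => (a : BH)) '' (J.ideal : Set A.alg)) :=
        A.isClosed.isClosedEmbedding_subtypeVal.isClosedMap _ J.isClosed
      have hc : Continuous fun η : CstarZ α => expX n * (η : BH) :=
        (continuous_const_mul (expX n)).comp continuous_subtype_val
      exact hJ.preimage hc⟩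

theorem mem_PsiRel {α : ℝ} (A : IntermediateAlgebra α) (J : ClosedIdeal A.alg) (n : ℤ)
    (η : CstarZ α) :
    η ∈ (PsiRel A J n).ideal ↔ ∃ a ∈ J.ideal, (a : BH) = expX n * (η : BH) :=
  by rw [PsiRel, TwoSidedIdeal.mem_mk']; rfl

/-- `Ψ_A` for `A = Φ(c)`, as a map from the closed ideals of `A` to the `c`-ideal functions,
given that its values are `c`-ideal functions. -/
def PsiInto {α : ℝ} (c : IdealFunction α)
    (h : ∀ J : ClosedIdeal (Phi c).alg, PsiRel (Phi c) J ≤ c.1)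
    (J : ClosedIdeal (Phi c).alg) : RelIdealFunction c :=
  ⟨PsiRel (Phi c) J, h J⟩

/-- The set `ℭ_c` of closed `c`-ideal functions, with the pointwise order. -/
abbrev ClosedRelIdealFunction {α : ℝ} (c : IdealFunction α) : Type :=
  {j : RelIdealFunction c // j.Closed}

end

end RotationAlgebra

open RotationAlgebra

/-! Conjugation by the unitary `koopman α` acts on a monomial `e^{inx} η` as the scalar `zⁿ`, with
`z = e^{iα}`. Since `α/2π` is irrational, `z` is not a root of unity, so the averages over `k < K`
of `z⁻ⁿᵏ` times the `k`-th iterate of this conjugation converge, as `K → ∞`, to the `n`-th Fourier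
coefficient (`exists_hasCoeff`). Fejér's theorem (`tendsto_fejerMean`) recovers an operator in the
closed span of the eigenspaces from its coefficients.

The Koopman operator lies in `A`, so a closed ideal `J` is invariant under the conjugation and
contains the coefficients of its elements. These are monomials, so they are recorded by `Ψ(J)`, and
Fejér's theorem gives `ΦΨ(J) = J`. The adjunction itself is formal.

Closed ideals of `C*_r(ℤ)` correspond to their zero sets (`hat_mem_iff`), and the covariance
relation `hatOp_mul_expX` turns products and adjoints of monomials into translates of functions.
Hence `Cif1` makes the monomials of `j` stable under adjoints, and `Cif2` makes them absorb the
monomials of `c`. For closed `j` the closed span of the monomials is then a two-sided ideal, and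
uniqueness of coefficients shows that it has no monomials beyond those of `j`, so `ΨΦ(j) = j`.
Conversely, multiplying monomials inside an ideal shows that every `Ψ(J)` is closed. The lattice
isomorphism follows formally. -/

namespace RotationAlgebra

noncomputable section

open Filter Topology

/-! ### Fourier coefficients with respect to a contraction, and Fejér's theorem -/

section Fejer

variable {E : Type*} [NormedAddCommGroup E] [NormedSpace ℂ E]

/-- The Cesàro average of order `K` of `z⁻ⁿᵏ gᵏ`. -/
def twistedAvg (g : E →L[ℂ] E) (z : ℂ) (n : ℤ) (K : ℕ) : E →L[ℂ] E :=
  (K : ℂ)⁻¹ • ∑ k ∈ Finset.range K, (z ^ (-n)) ^ k • g ^ k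

theorem twistedAvg_apply (g : E →L[ℂ] E) (z : ℂ) (n : ℤ) (K : ℕ) (a : E) :
    twistedAvg g z n K a = (K : ℂ)⁻¹ • ∑ k ∈ Finset.range K, (z ^ (-n)) ^ k • (g ^ k) a := by
  simp [twistedAvg]

/-- `b` is the `n`-th Fourier coefficient of `a`: the limit of the twisted averages. -/
def HasCoeff (g : E →L[ℂ] E) (z : ℂ) (n : ℤ) (a b : E) : Prop :=
  Tendsto (fun K => twistedAvg g z n K a) atTop (𝓝 b)

/-- The eigenspace of `g` for the eigenvalue `zⁿ`. -/
abbrev eig (g : E →L[ℂ] E) (z : ℂ) (n : ℤ) : Submodule ℂ E :=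
  Module.End.eigenspace (g : E →ₗ[ℂ] E) (z ^ n)

variable {g : E →L[ℂ] E} {z : ℂ}

theorem mem_eig {n : ℤ} {a : E} : a ∈ eig g z n ↔ g a = z ^ n • a :=
  Module.End.mem_eigenspace_iff

theorem HasCoeff.add {n : ℤ} {a a' b b' : E} (h : HasCoeff g z n a b)
    (h' : HasCoeff g z n a' b') : HasCoeff g z n (a + a') (b + b') := by
  simpa [HasCoeff] using Tendsto.add h h'

theorem HasCoeff.sub {n : ℤ} {a a' b b' : E} (h : HasCoeff g z n a b)
    (h' : HasCoeff g z n a' b') : HasCoeff g z n (a - a') (b - b') := by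
  simpa [HasCoeff] using Tendsto.sub h h'

theorem HasCoeff.zero (n : ℤ) : HasCoeff g z n 0 0 := by
  simp [HasCoeff]

theorem norm_pow_apply_le (hg : ∀ x, ‖g x‖ ≤ ‖x‖) (k : ℕ) (x : E) : ‖(g ^ k) x‖ ≤ ‖x‖ := by
  induction k with
  | zero => simp
  | succ k ih => rw [pow_succ']; exact (hg _).trans ih

theorem pow_apply_of_mem_eig {m : ℤ} {a : E} (ha : a ∈ eig g z m) (k : ℕ) :
    (g ^ k) a = (z ^ m) ^ k • a := by
  induction k with
  | zero => simp
  | succ k ih =>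
    rw [pow_succ', mul_apply_eq_comp, ih, map_smul, mem_eig.1 ha, smul_smul,
      ← pow_succ]

theorem norm_twistedAvg_apply_le (hg : ∀ x, ‖g x‖ ≤ ‖x‖) (hz : ‖z‖ = 1) (n : ℤ) (K : ℕ) (a : E) :
    ‖twistedAvg g z n K a‖ ≤ ‖a‖ := by
  rw [twistedAvg_apply, norm_smul]
  have h : ‖∑ k ∈ Finset.range K, (z ^ (-n)) ^ k • (g ^ k) a‖ ≤ K * ‖a‖ := by
    refine (norm_sum_le _ _).trans ((Finset.sum_le_card_nsmul _ _ ‖a‖ fun k _ => ?_).trans ?_)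
    · rw [norm_smul, norm_pow, norm_zpow, hz]
      simpa using norm_pow_apply_le hg k a
    · simp
  rcases Nat.eq_zero_or_pos K with rfl | hK
  · simp
  · have hK' : (0 : ℝ) < K := by exact_mod_cast hK
    rw [norm_inv, Complex.norm_natCast, inv_mul_le_iff₀ hK']
    exact h

theorem HasCoeff.norm_le (hg : ∀ x, ‖g x‖ ≤ ‖x‖) (hz : ‖z‖ = 1) {n : ℤ} {a b : E}
    (h : HasCoeff g z n a b) : ‖b‖ ≤ ‖a‖ :=
  le_of_tendsto (Tendsto.norm h)
    (Eventually.of_forall fun K => norm_twistedAvg_apply_le hg hz n K a)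

/-- For `w ≠ 1` on the unit circle the geometric sums stay bounded by `2 / ‖w - 1‖`, so dividing by
`K` kills them. -/
theorem tendsto_geom_average {w : ℂ} (hw : ‖w‖ = 1) (hw1 : w ≠ 1) :
    Tendsto (fun K : ℕ => (K : ℂ)⁻¹ * ∑ k ∈ Finset.range K, w ^ k) atTop (𝓝 0) := by
  have h1 : Tendsto (fun K : ℕ => (K : ℝ)⁻¹ * (2 / ‖w - 1‖)) atTop (𝓝 0) := by
    simpa using (tendsto_inv_atTop_nhds_zero_nat (𝕜 := ℝ)).mul_const (2 / ‖w - 1‖)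
  refine squeeze_zero_norm (fun K => ?_) h1
  rw [norm_mul, norm_inv, Complex.norm_natCast, geom_sum_eq hw1, norm_div]
  gcongr
  refine (norm_sub_le _ _).trans ?_
  rw [norm_pow, hw]
  norm_num

theorem hasCoeff_of_mem_eig (hz : ‖z‖ = 1) (hz1 : ∀ m : ℤ, m ≠ 0 → z ^ m ≠ 1) {m : ℤ} {a : E}
    (ha : a ∈ eig g z m) (n : ℤ) : HasCoeff g z n a (if n = m then a else 0) := by
  have hz0 : z ≠ 0 := by rintro rfl; simp at hz
  have key : ∀ K, twistedAvg g z n K a =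
      ((K : ℂ)⁻¹ * ∑ k ∈ Finset.range K, (z ^ (m - n)) ^ k) • a := by
    intro K
    rw [twistedAvg_apply, mul_smul, Finset.sum_smul]
    congr 1
    refine Finset.sum_congr rfl fun k _ => ?_
    rw [pow_apply_of_mem_eig ha, smul_smul, ← mul_pow, ← zpow_add₀ hz0, neg_add_eq_sub]
  unfold HasCoeff
  simp_rw [key]
  split_ifs with h
  · subst h
    refine tendsto_const_nhds.congr' ?_
    filter_upwards [eventually_gt_atTop 0] with K hK
    have : (K : ℂ) ≠ 0 := by exact_mod_cast hK.ne'
    simp [this]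
  · have := (tendsto_geom_average (w := z ^ (m - n)) (by rw [norm_zpow, hz, one_zpow])
      (hz1 _ (sub_ne_zero.2 (Ne.symm h)))).smul_const a
    simpa using this

theorem exists_hasCoeff_of_mem_iSup (hz : ‖z‖ = 1) (hz1 : ∀ m : ℤ, m ≠ 0 → z ^ m ≠ 1)
    {V : ℤ → Submodule ℂ E} (hV : ∀ n, V n ≤ eig g z n) {a : E} (ha : a ∈ ⨆ n, V n) (n : ℤ) :
    ∃ b ∈ V n, HasCoeff g z n a b := by
  induction ha using Submodule.iSup_induction' with
  | mem m x hx =>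
    refine ⟨_, ?_, hasCoeff_of_mem_eig hz hz1 (hV m hx) n⟩
    split_ifs with h
    · rwa [h]
    · exact zero_mem _
  | zero => exact ⟨0, zero_mem _, HasCoeff.zero n⟩
  | add x y _ _ hx hy =>
    obtain ⟨b, hb, hb'⟩ := hx
    obtain ⟨c, hc, hc'⟩ := hy
    exact ⟨b + c, add_mem hb hc, hb'.add hc'⟩

/-- The averages are contractions uniformly in `K`, so convergence passes from the algebraic sum to
its closure. The limit stays in `V n` because taking coefficients is contractive and `V n` is
closed. -/
theorem exists_hasCoeff [CompleteSpace E] (hg : ∀ x, ‖g x‖ ≤ ‖x‖) (hz : ‖z‖ = 1)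
    (hz1 : ∀ m : ℤ, m ≠ 0 → z ^ m ≠ 1)
    {V : ℤ → Submodule ℂ E} (hV : ∀ n, V n ≤ eig g z n) (hVc : ∀ n, IsClosed (V n : Set E))
    {a : E} (ha : a ∈ (⨆ n, V n).topologicalClosure) (n : ℤ) :
    ∃ b ∈ V n, HasCoeff g z n a b := by
  have happrox : ∀ ε > 0, ∃ a' ∈ ⨆ n, V n, dist a a' < ε := Metric.mem_closure_iff.1 ha
  have hC : CauchySeq fun K => twistedAvg g z n K a := by
    rw [Metric.cauchySeq_iff']
    intro ε hε
    obtain ⟨a', ha', hd⟩ := happrox (ε / 3) (by positivity)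
    obtain ⟨b, -, hb⟩ := exists_hasCoeff_of_mem_iSup hz hz1 hV ha' n
    obtain ⟨N, hN⟩ := Metric.cauchySeq_iff'.1 (Tendsto.cauchySeq hb) (ε / 3) (by positivity)
    have hdist : ∀ K, dist (twistedAvg g z n K a) (twistedAvg g z n K a') < ε / 3 := by
      intro K
      rw [dist_eq_norm, ← map_sub]
      rw [dist_eq_norm] at hd
      exact (norm_twistedAvg_apply_le hg hz n K _).trans_lt hd
    refine ⟨N, fun K hK => ?_⟩
    have h1 := hdist K
    have h2 := hdist N
    have h3 := hN K hK
    have h4 := dist_triangle4 (twistedAvg g z n K a) (twistedAvg g z n K a')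
      (twistedAvg g z n N a') (twistedAvg g z n N a)
    rw [dist_comm] at h2
    linarith
  obtain ⟨b, hb⟩ := cauchySeq_tendsto_of_complete hC
  refine ⟨b, ?_, hb⟩
  rw [← SetLike.mem_coe, ← (hVc n).closure_eq, Metric.mem_closure_iff]
  intro ε hε
  obtain ⟨a', ha', hd⟩ := happrox ε hε
  obtain ⟨b', hb'V, hb'⟩ := exists_hasCoeff_of_mem_iSup hz hz1 hV ha' n
  refine ⟨b', hb'V, ?_⟩
  rw [dist_eq_norm] at hd ⊢
  exact (HasCoeff.norm_le hg hz (HasCoeff.sub hb hb')).trans_lt hd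

/-! ### Fejér means and their convergence -/

/-- The `N`-th Fejér mean of a family of coefficients. -/
def fejerMean (b : ℤ → E) (N : ℕ) : E :=
  (N : ℂ)⁻¹ • ∑ i ∈ Finset.range N, ∑ j ∈ Finset.range N, b ((i : ℤ) - j)

theorem fejerMean_add (b c : ℤ → E) (N : ℕ) :
    fejerMean (b + c) N = fejerMean b N + fejerMean c N := by
  simp [fejerMean, Finset.sum_add_distrib, smul_add]

theorem fejerMean_sub (b c : ℤ → E) (N : ℕ) :
    fejerMean (b - c) N = fejerMean b N - fejerMean c N := by
  simp [fejerMean, Finset.sum_sub_distrib, smul_sub]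

theorem tendsto_fejerMean_twistedAvg {a : E} {b : ℤ → E} (h : ∀ n, HasCoeff g z n a (b n))
    (N : ℕ) :
    Tendsto (fun K => fejerMean (fun n => twistedAvg g z n K a) N) atTop (𝓝 (fejerMean b N)) :=
  (tendsto_finsetSum _ fun _ _ => tendsto_finsetSum _ fun _ _ => h _).const_smul _

/-- Writing the Fejér kernel as a double sum over differences `i - j` makes its positivity visible.
-/
theorem sum_sum_zpow_sub (hz : ‖z‖ = 1) (N k : ℕ) :
    ∑ i ∈ Finset.range N, ∑ j ∈ Finset.range N, (z ^ (-((i : ℤ) - j))) ^ k =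
      ((‖∑ i ∈ Finset.range N, (z ^ k) ^ i‖ ^ 2 : ℝ) : ℂ) := by
  have hz0 : z ≠ 0 := by rintro rfl; simp at hz
  have hconj : (starRingEnd ℂ) z = z⁻¹ := (Complex.inv_eq_conj hz).symm
  rw [← Complex.normSq_eq_norm_sq, Complex.normSq_eq_conj_mul_self, map_sum, Finset.sum_mul]
  refine Finset.sum_congr rfl fun i _ => ?_
  rw [Finset.mul_sum]
  refine Finset.sum_congr rfl fun j _ => ?_
  rw [map_pow, map_pow, hconj, neg_sub, sub_eq_add_neg, zpow_add₀ hz0, mul_pow, mul_comm,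
    zpow_natCast, zpow_neg, zpow_natCast, ← inv_pow, pow_right_comm, pow_right_comm z]

theorem fejerMean_twistedAvg (hz : ‖z‖ = 1) (a : E) (N K : ℕ) :
    fejerMean (fun n => twistedAvg g z n K a) N = ((N : ℂ)⁻¹ * (K : ℂ)⁻¹) •
      ∑ k ∈ Finset.range K, ((‖∑ i ∈ Finset.range N, (z ^ k) ^ i‖ ^ 2 : ℝ) : ℂ) • (g ^ k) a := by
  simp_rw [← sum_sum_zpow_sub hz, fejerMean, twistedAvg_apply, mul_smul, ← Finset.smul_sum,
    Finset.sum_smul]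
  congr 2
  exact (Finset.sum_congr rfl fun i _ => Finset.sum_comm).trans Finset.sum_comm

/-- The weights of the iterates of `g` are nonnegative, so the triangle inequality bounds the mean
by the total weight, which is the same expression for the identity of `ℂ` at `1`. -/
theorem norm_fejerMean_twistedAvg_le (hg : ∀ x, ‖g x‖ ≤ ‖x‖) (hz : ‖z‖ = 1) (a : E) (N K : ℕ) :
    ‖fejerMean (fun n => twistedAvg g z n K a) N‖ ≤
      ‖fejerMean (fun n => twistedAvg (ContinuousLinearMap.id ℂ ℂ) z n K 1) N‖ * ‖a‖ := by
  rw [fejerMean_twistedAvg hz, fejerMean_twistedAvg hz, norm_smul, norm_smul, mul_assoc]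
  refine mul_le_mul_of_nonneg_left ?_ (norm_nonneg _)
  have h1 : ∀ k : ℕ, ((ContinuousLinearMap.id ℂ ℂ) ^ k) 1 = 1 := fun k => by
    rw [← ContinuousLinearMap.one_def, one_pow]; rfl
  simp_rw [h1, smul_eq_mul, mul_one, ← Complex.ofReal_sum, Complex.norm_real]
  rw [Real.norm_of_nonneg (by positivity), Finset.sum_mul]
  refine norm_sum_le_of_le _ fun k _ => ?_
  rw [norm_smul, Complex.norm_real, Real.norm_of_nonneg (by positivity)]
  gcongr
  exact norm_pow_apply_le hg k a

theorem norm_fejerMean_le (hg : ∀ x, ‖g x‖ ≤ ‖x‖) (hz : ‖z‖ = 1)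
    (hz1 : ∀ m : ℤ, m ≠ 0 → z ^ m ≠ 1) {a : E} {b : ℤ → E} (h : ∀ n, HasCoeff g z n a (b n))
    {N : ℕ} (hN : 0 < N) : ‖fejerMean b N‖ ≤ ‖a‖ := by
  -- In the scalar model the coefficients are those of the constant `1`, and only the `N` diagonal
  -- pairs contribute, so the total weight tends to `1` as `K → ∞`.
  have hs : ∀ n : ℤ, HasCoeff (ContinuousLinearMap.id ℂ ℂ) z n 1 (if n = 0 then 1 else 0) :=
    hasCoeff_of_mem_eig hz hz1 (mem_eig.2 (by simp))
  have hone : fejerMean (fun n : ℤ => if n = 0 then (1 : ℂ) else 0) N = 1 := by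
    have hN' : (N : ℂ) ≠ 0 := by exact_mod_cast hN.ne'
    have : ∀ i ∈ Finset.range N, ∑ j ∈ Finset.range N,
        (if (i : ℤ) - j = 0 then (1 : ℂ) else 0) = 1 := by
      intro i hi
      simp_rw [sub_eq_zero, Nat.cast_inj]
      rw [Finset.sum_ite_eq, if_pos hi]
    rw [fejerMean, Finset.sum_congr rfl this]
    simp [hN']
  have h2 := (tendsto_fejerMean_twistedAvg hs N).norm.mul_const ‖a‖
  rw [hone, norm_one, one_mul] at h2
  exact le_of_tendsto_of_tendsto (tendsto_fejerMean_twistedAvg h N).norm h2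
    (Eventually.of_forall fun K => norm_fejerMean_twistedAvg_le hg hz a N K)

/-- Row `i` of the double sum equals `a` unless `i - m` leaves `[0, N)`, which happens for at most
`|m|` rows. -/
theorem norm_fejerMean_single_sub_le (m : ℤ) (a : E) {N : ℕ} (hN : 0 < N) :
    ‖fejerMean (fun n => if n = m then a else 0) N - a‖ ≤ (N : ℝ)⁻¹ * (|m| * ‖a‖) := by
  have hN' : (N : ℂ) ≠ 0 := by exact_mod_cast hN.ne'
  have hsum : ∀ i ∈ Finset.range N, ∑ j ∈ Finset.range N, (if (i : ℤ) - j = m then a else 0) - a =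
      if 0 ≤ (i : ℤ) - m ∧ (i : ℤ) - m < N then 0 else -a := by
    intro i _
    split_ifs with h
    · rw [Finset.sum_eq_single_of_mem ((i : ℤ) - m).toNat]
      · rw [if_pos (by omega), sub_self]
      · rw [Finset.mem_range]; omega
      · intro j _ hj
        rw [if_neg (by omega)]
    · rw [Finset.sum_eq_zero, zero_sub]
      intro j hj
      rw [Finset.mem_range] at hj
      rw [if_neg (by omega)]
  have h1 : fejerMean (fun n => if n = m then a else 0) N - a = (N : ℂ)⁻¹ •
      ∑ i ∈ Finset.range N, if 0 ≤ (i : ℤ) - m ∧ (i : ℤ) - m < N then 0 else -a := by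
    rw [← Finset.sum_congr rfl hsum, Finset.sum_sub_distrib, smul_sub, fejerMean]
    congr 1
    rw [Finset.sum_const, Finset.card_range, ← Nat.cast_smul_eq_nsmul ℂ, smul_smul,
      inv_mul_cancel₀ hN', one_smul]
  rw [h1, norm_smul, norm_inv, Complex.norm_natCast]
  gcongr
  have hfilter : ∀ i : ℕ, (if 0 ≤ (i : ℤ) - m ∧ (i : ℤ) - m < N then 0 else -a) =
      if ¬(0 ≤ (i : ℤ) - m ∧ (i : ℤ) - m < N) then -a else 0 := fun i => (ite_not _ _ _).symm
  simp_rw [hfilter]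
  rw [← Finset.sum_filter, Finset.sum_const, ← Nat.cast_smul_eq_nsmul ℝ, norm_smul, norm_neg,
    Real.norm_natCast]
  gcongr
  -- The bad rows are the first `m` or the last `|m|`, according to the sign of `m`. Truncation of
  -- `N - m.natAbs` is harmless, since all rows are then allowed and `N ≤ |m|`.
  have hsub : (Finset.range N).filter (fun i : ℕ => ¬(0 ≤ (i : ℤ) - m ∧ (i : ℤ) - m < N)) ⊆
      if 0 ≤ m then Finset.range m.natAbs else Finset.Ico (N - m.natAbs) N := by
    intro i hi
    rw [Finset.mem_filter, Finset.mem_range] at hi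
    split_ifs with h
    · rw [Finset.mem_range]; omega
    · rw [Finset.mem_Ico]; omega
  have hcard := Finset.card_le_card hsub
  have h3 : (Finset.card (if 0 ≤ m then Finset.range m.natAbs
      else Finset.Ico (N - m.natAbs) N)) ≤ m.natAbs := by
    split_ifs
    · simp
    · rw [Nat.card_Ico]; omega
  calc ((Finset.card _ : ℕ) : ℝ) ≤ (m.natAbs : ℝ) := by exact_mod_cast hcard.trans h3
    _ = ((|m| : ℤ) : ℝ) := by rw [Nat.cast_natAbs]

theorem tendsto_fejerMean_single (m : ℤ) (a : E) :
    Tendsto (fejerMean fun n => if n = m then a else 0) atTop (𝓝 a) := by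
  rw [tendsto_iff_norm_sub_tendsto_zero]
  have h1 : Tendsto (fun N : ℕ => (N : ℝ)⁻¹ * (|m| * ‖a‖)) atTop (𝓝 0) := by
    simpa using (tendsto_inv_atTop_nhds_zero_nat (𝕜 := ℝ)).mul_const (|m| * ‖a‖)
  refine squeeze_zero' (Eventually.of_forall fun N => norm_nonneg _) ?_ h1
  filter_upwards [eventually_gt_atTop 0] with N hN
  exact norm_fejerMean_single_sub_le m a hN

theorem exists_tendsto_fejerMean_of_mem_iSup (hz : ‖z‖ = 1)
    (hz1 : ∀ m : ℤ, m ≠ 0 → z ^ m ≠ 1) {a : E} (ha : a ∈ ⨆ n, eig g z n) :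
    ∃ b : ℤ → E, (∀ n, HasCoeff g z n a (b n)) ∧ Tendsto (fejerMean b) atTop (𝓝 a) := by
  induction ha using Submodule.iSup_induction' with
  | mem m x hx => exact ⟨_, hasCoeff_of_mem_eig hz hz1 hx, tendsto_fejerMean_single m x⟩
  | zero =>
    refine ⟨0, fun n => HasCoeff.zero n, ?_⟩
    have : fejerMean (0 : ℤ → E) = fun _ => 0 := by ext N; simp [fejerMean]
    rw [this]
    exact tendsto_const_nhds
  | add x y _ _ hx hy =>
    obtain ⟨b, hb, hb'⟩ := hx
    obtain ⟨c, hc, hc'⟩ := hy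
    refine ⟨b + c, fun n => (hb n).add (hc n), ?_⟩
    have : fejerMean (b + c) = fun N => fejerMean b N + fejerMean c N :=
      funext (fejerMean_add b c)
    rw [this]
    exact hb'.add hc'

/-- **Fejér's theorem**: an element of the closed span of the eigenspaces is the limit of the
Fejér means of its coefficients. -/
theorem tendsto_fejerMean (hg : ∀ x, ‖g x‖ ≤ ‖x‖) (hz : ‖z‖ = 1)
    (hz1 : ∀ m : ℤ, m ≠ 0 → z ^ m ≠ 1) {a : E} (ha : a ∈ (⨆ n, eig g z n).topologicalClosure)
    {b : ℤ → E} (h : ∀ n, HasCoeff g z n a (b n)) : Tendsto (fejerMean b) atTop (𝓝 a) := by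
  rw [Metric.tendsto_atTop]
  intro ε hε
  obtain ⟨a', ha', hd⟩ := Metric.mem_closure_iff.1 ha (ε / 3) (by positivity)
  obtain ⟨b', hb', ht⟩ := exists_tendsto_fejerMean_of_mem_iSup hz hz1 ha'
  obtain ⟨N, hN⟩ := Metric.tendsto_atTop.1 ht (ε / 3) (by positivity)
  -- The shift by one excludes the mean of order `0`, for which the contraction bound is not
  -- available.
  refine ⟨N + 1, fun n hn => ?_⟩
  have h1 : dist (fejerMean b n) (fejerMean b' n) ≤ dist a a' := by
    rw [dist_eq_norm, dist_eq_norm, ← fejerMean_sub]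
    exact norm_fejerMean_le hg hz hz1 (fun k => (h k).sub (hb' k)) (by omega)
  have h2 := hN n (by omega)
  have h3 := dist_triangle4 (fejerMean b n) (fejerMean b' n) a' a
  rw [dist_comm a' a] at h3
  linarith

/-- Fejér means are finite linear combinations of coefficients, so membership in a closed subspace
can be tested on coefficients. -/
theorem mem_of_hasCoeff (hg : ∀ x, ‖g x‖ ≤ ‖x‖) (hz : ‖z‖ = 1)
    (hz1 : ∀ m : ℤ, m ≠ 0 → z ^ m ≠ 1) {a : E} (ha : a ∈ (⨆ n, eig g z n).topologicalClosure)
    {b : ℤ → E} (h : ∀ n, HasCoeff g z n a (b n)) {S : Submodule ℂ E} (hS : IsClosed (S : Set E))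
    (hb : ∀ n, b n ∈ S) : a ∈ S :=
  hS.mem_of_tendsto (tendsto_fejerMean hg hz hz1 ha h) (Eventually.of_forall fun _ =>
    S.smul_mem _ (S.sum_mem fun _ _ => S.sum_mem fun _ _ => hb _))

end Fejer

/-! ### The exponentials and the Koopman operator -/

theorem expX_add (m n : ℤ) : expX (m + n) = expX m * expX n := by
  ext1 v
  apply Lp.ext
  filter_upwards [coeFn_mulOp (fourier (m + n)) v, coeFn_mulOp (fourier n) v,
    coeFn_mulOp (fourier m) (expX n v)] with x h1 h2 h3
  refine Eq.trans h1 (Eq.trans ?_ (Eq.symm h3))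
  rw [show expX n v x = _ from h2, fourier_add, mul_assoc]

theorem star_expX (n : ℤ) : star (expX n) = expX (-n) := by
  rw [ContinuousLinearMap.star_eq_adjoint, eq_comm, ContinuousLinearMap.eq_adjoint_iff]
  intro v w
  rw [L2.inner_def, L2.inner_def]
  refine integral_congr_ae ?_
  filter_upwards [coeFn_mulOp (fourier (-n)) v, coeFn_mulOp (fourier n) w] with x h1 h2
  rw [show expX (-n) v x = _ from h1, show expX n w x = _ from h2, fourier_neg]
  simp only [RCLike.inner_apply, map_mul, Complex.conj_conj]
  ring

theorem expX_neg_mul_expX (n : ℤ) : expX (-n) * expX n = 1 := by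
  rw [← expX_add, neg_add_cancel, expX_zero]

theorem expX_mul_expX_neg (n : ℤ) : expX n * expX (-n) = 1 := by
  rw [← expX_add, add_neg_cancel, expX_zero]

/-- The scalar `e^{iα}`. -/
def phase (α : ℝ) : ℂ := Complex.exp (α * Complex.I)

theorem norm_phase (α : ℝ) : ‖phase α‖ = 1 := Complex.norm_exp_ofReal_mul_I α

theorem phase_ne_zero (α : ℝ) : phase α ≠ 0 := Complex.exp_ne_zero _

theorem phase_zpow (α : ℝ) (n : ℤ) : phase α ^ n = Complex.exp (n * (α * Complex.I)) := by
  rw [phase, Complex.exp_int_mul]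

theorem fourier_coe_eq_phase_zpow (α : ℝ) (n : ℤ) :
    fourier n (α : Circ) = phase α ^ n := by
  rw [phase_zpow, fourier_coe_apply]
  congr 1
  push_cast
  have : (π : ℂ) ≠ 0 := by exact_mod_cast Real.pi_ne_zero
  field_simp

theorem phase_zpow_ne_one {α : ℝ} (hα : Irrational (α / (2 * Real.pi))) {m : ℤ} (hm : m ≠ 0) :
    phase α ^ m ≠ 1 := by
  rw [phase_zpow, Ne, Complex.exp_eq_one_iff]
  rintro ⟨k, hk⟩
  have hk' : (m * α : ℂ) = k * (2 * π) := by
    have hI := Complex.I_ne_zero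
    apply mul_right_cancel₀ hI
    rw [mul_assoc, hk]; ring
  have hk'' : (m * α : ℝ) = k * (2 * π) := by exact_mod_cast hk'
  apply hα
  refine ⟨(k : ℚ) / m, ?_⟩
  have hm' : (m : ℝ) ≠ 0 := by exact_mod_cast hm
  have := Real.pi_pos
  push_cast
  field_simp
  linarith

theorem koopman_mul_expX (α : ℝ) (n : ℤ) :
    koopman α * expX n = phase α ^ n • (expX n * koopman α) := by
  ext1 v
  apply Lp.ext
  have hm := measurePreserving_add_right (AddCircle.haarAddCircle : Measure Circ) (α : Circ)
  have h1 := Lp.coeFn_compMeasurePreserving (expX n v) hm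
  have h2 := hm.quasiMeasurePreserving.ae (coeFn_mulOp (fourier n) v)
  have h3 := coeFn_mulOp (fourier n) (koopman α v)
  have h4 := Lp.coeFn_compMeasurePreserving v hm
  have h5 := Lp.coeFn_smul (phase α ^ n) (expX n (koopman α v))
  filter_upwards [h1, h2, h3, h4, h5] with x h1 h2 h3 h4 h5
  refine Eq.trans h1 (Eq.trans h2 (Eq.trans ?_ (Eq.symm h5)))
  rw [Pi.smul_apply, show expX n (koopman α v) x = _ from h3, show koopman α v x = _ from h4,
    ← fourier_coe_eq_phase_zpow, smul_eq_mul, Function.comp_apply]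
  have : fourier n (x + (α : Circ)) = fourier n x * fourier n (α : Circ) := by
    simp only [fourier_apply, smul_add, AddCircle.toCircle_add, Circle.coe_mul]
  rw [this]; ring

/-! ### The identification of `C(S¹)` with the group algebra -/

theorem continuous_hat (α : ℝ) : Continuous (hat α) := by
  refine (StarAlgEquiv.isometry (continuousFunctionalCalculus (koopman α))).continuous.comp ?_
  exact ContinuousMap.continuous_precomp _

/-- The spectrum embeds as a closed subset of the circle, so Tietze extension lifts any function on
it. Whether the spectrum is the whole circle plays no role. -/
theorem hat_surjective (α : ℝ) : Function.Surjective (hat α) := by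
  intro η
  have hinj : Function.Injective (spectrumToCirc α) := by
    intro x y hxy
    have h := AddCircle.homeomorphCircle'.symm.injective hxy
    exact Subtype.ext (congrArg (fun w : Circle => (w : ℂ)) h)
  have he : Topology.IsClosedEmbedding (spectrumToCirc α) :=
    (spectrumToCirc α).continuous.isClosedEmbedding hinj
  obtain ⟨φ, hφ⟩ := ContinuousMap.exists_extension he
    ((continuousFunctionalCalculus (koopman α)).symm η)
  refine ⟨φ, ?_⟩
  change continuousFunctionalCalculus (koopman α)
    (ContinuousMap.compStarAlgHom' ℂ ℂ (spectrumToCirc α) φ) = η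
  rw [show ContinuousMap.compStarAlgHom' ℂ ℂ (spectrumToCirc α) φ =
    (continuousFunctionalCalculus (koopman α)).symm η from hφ, StarAlgEquiv.apply_symm_apply]

/-- The function `φ ∘ τⁿ` on `S¹`. -/
def shift (α : ℝ) (n : ℤ) (φ : C(Circ, ℂ)) : C(Circ, ℂ) :=
  φ.comp ⟨fun t => t + n • (α : Circ), continuous_add_const _⟩

@[simp]
theorem shift_apply (α : ℝ) (n : ℤ) (φ : C(Circ, ℂ)) (t : Circ) :
    shift α n φ t = φ (t + n • (α : Circ)) := rfl

theorem continuous_shift (α : ℝ) (n : ℤ) : Continuous (shift α n) :=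
  ContinuousMap.continuous_precomp _

/-- `φ ↦ φ̂`, with values in the bounded operators. -/
def hatOp (α : ℝ) : C(Circ, ℂ) →⋆ₐ[ℂ] BH := (CstarZ α).subtype.comp (hat α)

theorem coe_hat (α : ℝ) (φ : C(Circ, ℂ)) : (hat α φ : BH) = hatOp α φ := rfl

theorem exists_coe_eq_hatOp {α : ℝ} (η : CstarZ α) : ∃ φ, hat α φ = η ∧ (η : BH) = hatOp α φ := by
  obtain ⟨φ, rfl⟩ := hat_surjective α η
  exact ⟨φ, rfl, rfl⟩

theorem continuous_hatOp (α : ℝ) : Continuous (hatOp α) :=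
  continuous_subtype_val.comp (continuous_hat α)

theorem zpow_commutation {A : Type*} [Ring A] [Algebra ℂ A] {u : ℤ → A}
    (hadd : ∀ k l, u (k + l) = u k * u l) (h0 : u 0 = 1) {v : A} {c : ℂ} (hc : c ≠ 0)
    (h : u 1 * v = c • (v * u 1)) (k : ℤ) : u k * v = c ^ k • (v * u k) := by
  have h1 : u (-1) * u 1 = 1 := by rw [← hadd, neg_add_cancel, h0]
  have h2 : u 1 * u (-1) = 1 := by rw [← hadd, add_neg_cancel, h0]
  have hneg : u (-1) * v = c⁻¹ • (v * u (-1)) := by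
    have h3 : v = c • (u (-1) * (v * u 1)) := by
      rw [← mul_smul_comm, ← h, ← mul_assoc, h1, one_mul]
    conv_rhs => rw [h3]
    rw [smul_mul_assoc, smul_smul, inv_mul_cancel₀ hc, one_smul, mul_assoc, mul_assoc, h2, mul_one]
  induction k using Int.induction_on with
  | zero => simp [h0]
  | succ k ih =>
    rw [hadd, mul_assoc, h, mul_smul_comm, ← mul_assoc, ih, smul_mul_assoc, smul_smul,
      zpow_add_one₀ hc, mul_comm c, mul_assoc]
  | pred k ih =>
    rw [sub_eq_add_neg, hadd, mul_assoc, hneg, mul_smul_comm, ← mul_assoc, ih, smul_mul_assoc,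
      smul_smul, ← sub_eq_add_neg, zpow_sub_one₀ hc, mul_comm c⁻¹, mul_assoc]

theorem hatOp_fourier_mul_expX (α : ℝ) (k n : ℤ) :
    hatOp α (fourier k) * expX n = (phase α ^ n) ^ k • (expX n * hatOp α (fourier k)) := by
  refine zpow_commutation (u := fun k => hatOp α (fourier k)) (fun k l => ?_) ?_
    (zpow_ne_zero _ (phase_ne_zero α)) ?_ k
  · rw [← map_mul]
    congr 1
    ext t
    exact fourier_add
  · have : (fourier 0 : C(Circ, ℂ)) = 1 := by ext t; simp
    rw [this, map_one]
  · rw [← coe_hat, hat_fourier_one, koopman_mul_expX]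

theorem fourier_add_apply (k : ℤ) (s t : Circ) : fourier k (s + t) = fourier k s * fourier k t := by
  simp only [fourier_apply, smul_add, AddCircle.toCircle_add, Circle.coe_mul]

theorem shift_fourier (α : ℝ) (n k : ℤ) :
    shift α n (fourier k) = ((phase α ^ n) ^ k) • fourier k := by
  ext t
  have h : fourier k (n • (α : Circ)) = (phase α ^ n) ^ k := by
    rw [← AddCircle.coe_zsmul, zsmul_eq_mul, fourier_coe_eq_phase_zpow, phase_zpow, phase_zpow,
      ← Complex.exp_int_mul]
    congr 2
    push_cast
    ring
  rw [shift_apply, fourier_add_apply, h, ContinuousMap.smul_apply, smul_eq_mul, mul_comm]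

/-- The covariance relation. -/
theorem hatOp_mul_expX (α : ℝ) (n : ℤ) (φ : C(Circ, ℂ)) :
    hatOp α φ * expX n = expX n * hatOp α (shift α n φ) := by
  -- Both sides are linear and continuous in `φ`, so the density of trigonometric polynomials
  -- reduces the relation to `fourier k`.
  have hcl : IsClosed {φ | hatOp α φ * expX n = expX n * hatOp α (shift α n φ)} :=
    isClosed_eq ((continuous_hatOp α).mul continuous_const)
      (continuous_const.mul ((continuous_hatOp α).comp (continuous_shift α n)))
  have hspan : (Submodule.span ℂ (Set.range (fourier (T := 2 * π))) : Set C(Circ, ℂ)) ⊆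
      {φ | hatOp α φ * expX n = expX n * hatOp α (shift α n φ)} := by
    intro φ hφ
    rw [Set.mem_ofPred_eq]
    induction hφ using Submodule.span_induction with
    | mem _ h =>
      obtain ⟨k, rfl⟩ := h
      rw [shift_fourier, hatOp_fourier_mul_expX, map_smul, mul_smul_comm]
    | zero =>
      rw [show shift α n 0 = 0 from rfl, map_zero, zero_mul, mul_zero]
    | add x y _ _ hx hy =>
      rw [show shift α n (x + y) = shift α n x + shift α n y from rfl, map_add, map_add, add_mul,
        mul_add, hx, hy]
    | smul c x _ hx =>
      rw [show shift α n (c • x) = c • shift α n x from rfl, map_smul, map_smul, smul_mul_assoc,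
        mul_smul_comm, hx]
  have h := hcl.closure_subset_iff.2 hspan
  rw [← Submodule.topologicalClosure_coe, span_fourier_closure_eq_top] at h
  exact h trivial

theorem star_expX_mul_hatOp (α : ℝ) (n : ℤ) (φ : C(Circ, ℂ)) :
    star (expX n * hatOp α φ) = expX (-n) * hatOp α (shift α (-n) (star φ)) := by
  rw [star_mul, star_expX, ← hatOp_mul_expX, map_star]

theorem expX_mul_hatOp_mul (α : ℝ) (m n : ℤ) (φ ψ : C(Circ, ℂ)) :
    expX m * hatOp α φ * (expX n * hatOp α ψ) =
      expX (m + n) * hatOp α (shift α n φ * ψ) := by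
  rw [mul_assoc, ← mul_assoc (hatOp α φ), hatOp_mul_expX, expX_add, map_mul]
  simp only [mul_assoc]

/-- A closed ideal of `C*_r(ℤ)` is determined by its zero set. -/
theorem hat_mem_iff {α : ℝ} (I : ClosedIdeal (CstarZ α)) (φ : C(Circ, ℂ)) :
    hat α φ ∈ I.ideal ↔ ∀ t ∈ zeroSet I, φ t = 0 := by
  refine ⟨fun h t ht => ht φ h, fun h => ?_⟩
  -- Pulled back to `C(S¹)`, the ideal is closed and hence consists of all functions vanishing on
  -- its zero set.
  let K : Ideal C(Circ, ℂ) := (TwoSidedIdeal.asIdeal I.ideal).comap (hat α : C(Circ, ℂ) →+* CstarZ α)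
  have hmem : ∀ ψ, ψ ∈ K ↔ hat α ψ ∈ I.ideal := fun ψ => by
    rw [Ideal.mem_comap, TwoSidedIdeal.mem_asIdeal]; rfl
  have hK : IsClosed (K : Set C(Circ, ℂ)) := by
    have : (K : Set C(Circ, ℂ)) = hat α ⁻¹' (I.ideal : Set (CstarZ α)) := Set.ext hmem
    rw [this]
    exact I.isClosed.preimage (continuous_hat α)
  rw [← hmem, ← ContinuousMap.idealOfSet_ofIdeal_isClosed hK, ContinuousMap.mem_idealOfSet]
  intro t ht
  rw [Set.mem_compl_iff, ContinuousMap.notMem_setOfIdeal] at ht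
  exact h t fun ψ hψ => ht ((hmem ψ).2 hψ)

theorem mem_rot_zpow_image {α : ℝ} {n : ℤ} {S : Set Circ} {t : Circ} :
    t ∈ (rot α ^ n) '' S ↔ t - n • (α : Circ) ∈ S := by
  have h : ∀ (n : ℤ) (s : Circ), (rot α ^ n) s = s + n • (α : Circ) := by
    intro n
    induction n using Int.induction_on with
    | zero => simp
    | succ n ih =>
      intro s
      rw [zpow_add_one, Equiv.Perm.mul_apply, ih, rot, Equiv.coe_addRight, add_zsmul, one_zsmul,
        add_assoc, add_comm (α : Circ)]
    | pred n ih =>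
      intro s
      rw [zpow_sub_one, Equiv.Perm.mul_apply, ih, rot, Equiv.Perm.inv_def, Equiv.addRight_symm,
        Equiv.coe_addRight, sub_zsmul, one_zsmul, add_assoc,
        add_comm (-(α : Circ))]
  constructor
  · rintro ⟨s, hs, rfl⟩
    rwa [h, add_sub_cancel_right]
  · intro hs
    exact ⟨_, hs, by rw [h, sub_add_cancel]⟩

/-! ### Closed spans of monomials -/

/-- The monomials `e^{inx} η` of degree `n` with `η ∈ I`. -/
def monomials {α : ℝ} (I : ClosedIdeal (CstarZ α)) (n : ℤ) : Submodule ℂ BH where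
  carrier := {a | ∃ φ, hat α φ ∈ I.ideal ∧ a = expX n * hatOp α φ}
  zero_mem' := ⟨0, (hat_mem_iff I 0).2 fun _ _ => rfl, by rw [map_zero, mul_zero]⟩
  add_mem' := by
    rintro _ _ ⟨φ, hφ, rfl⟩ ⟨ψ, hψ, rfl⟩
    rw [hat_mem_iff] at hφ hψ
    refine ⟨φ + ψ, (hat_mem_iff I _).2 fun t ht => ?_, by rw [map_add, mul_add]⟩
    rw [ContinuousMap.add_apply, hφ t ht, hψ t ht, add_zero]
  smul_mem' := by
    rintro c _ ⟨φ, hφ, rfl⟩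
    rw [hat_mem_iff] at hφ
    refine ⟨c • φ, (hat_mem_iff I _).2 fun t ht => ?_, by rw [map_smul, mul_smul_comm]⟩
    rw [ContinuousMap.smul_apply, hφ t ht, smul_zero]

theorem expX_mul_coe_mem_monomials {α : ℝ} {I : ClosedIdeal (CstarZ α)} {n : ℤ} {η : CstarZ α} :
    expX n * (η : BH) ∈ monomials I n ↔ η ∈ I.ideal := by
  constructor
  · rintro ⟨φ, hφ, h⟩
    have h2 : (η : BH) = hatOp α φ := by
      simpa only [← mul_assoc, expX_neg_mul_expX, one_mul] using congrArg (expX (-n) * ·) h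
    rwa [Subtype.ext (h2.trans (coe_hat α φ).symm)]
  · intro h
    obtain ⟨φ, hφ, hφ'⟩ := exists_coe_eq_hatOp η
    exact ⟨φ, by rwa [hφ], by rw [hφ']⟩

theorem isClosed_monomials {α : ℝ} (I : ClosedIdeal (CstarZ α)) (n : ℤ) :
    IsClosed (monomials I n : Set BH) := by
  have hI : IsClosed ((fun η : CstarZ α => (η : BH)) '' (I.ideal : Set (CstarZ α))) :=
    (StarAlgebra.elemental.isClosed ℂ (koopman α)).isClosedEmbedding_subtypeVal.isClosedMap _
      I.isClosed
  have h : (monomials I n : Set BH) = (fun a => expX (-n) * a) ⁻¹'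
      ((fun η : CstarZ α => (η : BH)) '' (I.ideal : Set (CstarZ α))) := by
    ext a
    constructor
    · rintro ⟨φ, hφ, rfl⟩
      exact ⟨_, hφ, by simp only [coe_hat, ← mul_assoc, expX_neg_mul_expX, one_mul]⟩
    · rintro ⟨η, hη, h⟩
      have : a = expX n * (η : BH) := by
        simp only at h
        rw [h, ← mul_assoc, expX_mul_expX_neg, one_mul]
      rw [this]
      exact expX_mul_coe_mem_monomials.2 hη
  rw [h]
  exact hI.preimage (continuous_const_mul _)

/-! ### The grading by conjugation, and closed spans of monomials -/

/-- Conjugation by `λ₁`. -/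
def conjKoopman (α : ℝ) : BH →L[ℂ] BH :=
  ContinuousLinearMap.mulLeftRight ℂ BH (koopman α) (star (koopman α))

theorem conjKoopman_apply (α : ℝ) (a : BH) :
    conjKoopman α a = koopman α * a * star (koopman α) := rfl

theorem norm_conjKoopman_le (α : ℝ) (a : BH) : ‖conjKoopman α a‖ ≤ ‖a‖ := by
  rw [conjKoopman_apply, CStarRing.norm_mul_mem_unitary _ (Unitary.star_mem (koopman_mem_unitary α)),
    CStarRing.norm_mem_unitary_mul _ (koopman_mem_unitary α)]

theorem monomials_le_eig {α : ℝ} (I : ClosedIdeal (CstarZ α)) (n : ℤ) :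
    monomials I n ≤ eig (conjKoopman α) (phase α) n := by
  rintro _ ⟨φ, -, rfl⟩
  have hcomm : koopman α * hatOp α φ = hatOp α φ * koopman α := by
    rw [← hat_fourier_one, coe_hat, ← map_mul, ← map_mul, mul_comm (fourier 1) φ]
  rw [mem_eig, conjKoopman_apply, ← mul_assoc (koopman α), koopman_mul_expX, smul_mul_assoc,
    smul_mul_assoc, mul_assoc (expX n), hcomm, mul_assoc, mul_assoc,
    Unitary.mul_star_self_of_mem (koopman_mem_unitary α), mul_one]

/-- The closed linear span of the monomials `e^{inx} η` with `η ∈ j n`. -/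
def closedSpan {α : ℝ} (j : ℤ → ClosedIdeal (CstarZ α)) : Submodule ℂ BH :=
  (⨆ n, monomials (j n) n).topologicalClosure

theorem monomials_le_closedSpan {α : ℝ} (j : ℤ → ClosedIdeal (CstarZ α)) (n : ℤ) :
    monomials (j n) n ≤ closedSpan j :=
  (le_iSup (fun n => monomials (j n) n) n).trans (Submodule.le_topologicalClosure _)

theorem exists_hasCoeff_of_mem_closedSpan {α : ℝ} (hα : Irrational (α / (2 * Real.pi)))
    {j : ℤ → ClosedIdeal (CstarZ α)} {a : BH} (ha : a ∈ closedSpan j) (n : ℤ) :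
    ∃ b ∈ monomials (j n) n, HasCoeff (conjKoopman α) (phase α) n a b :=
  exists_hasCoeff (norm_conjKoopman_le α) (norm_phase α) (fun _ => phase_zpow_ne_one hα)
    (fun n => monomials_le_eig (j n) n) (fun n => isClosed_monomials (j n) n) ha n

/-- A monomial of degree `n` is its own `n`-th coefficient, and the `n`-th coefficient of an element
of the closed span lies in `monomials (j n) n`. -/
theorem expX_mul_coe_mem_closedSpan {α : ℝ} (hα : Irrational (α / (2 * Real.pi)))
    {j : ℤ → ClosedIdeal (CstarZ α)} {n : ℤ} {η : CstarZ α} :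
    expX n * (η : BH) ∈ closedSpan j ↔ η ∈ (j n).ideal := by
  refine ⟨fun h => ?_, fun h =>
    monomials_le_closedSpan j n (expX_mul_coe_mem_monomials.2 h)⟩
  obtain ⟨b, hb, hb'⟩ := exists_hasCoeff_of_mem_closedSpan hα h n
  obtain ⟨φ, -, hφ⟩ := exists_coe_eq_hatOp η
  have heig : expX n * (η : BH) ∈ eig (conjKoopman α) (phase α) n := by
    -- The unit ideal serves here because nothing is yet known about `η` relative to `j n`.
    refine monomials_le_eig ⟨⊤, isClosed_univ⟩ n ⟨φ, ?_, by rw [hφ]⟩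
    trivial
  have hself := hasCoeff_of_mem_eig (norm_phase α) (fun _ => phase_zpow_ne_one hα) heig n
  rw [if_pos rfl] at hself
  rwa [← expX_mul_coe_mem_monomials (n := n), tendsto_nhds_unique hself hb']

/-- Three families are allowed so that both uses are covered: `c` times `c` for the algebra, and `c`
times `j` for its ideals. -/
theorem mul_mem_closedSpan {α : ℝ} {i j k : ℤ → ClosedIdeal (CstarZ α)}
    (h : ∀ m n, ∀ a ∈ monomials (i m) m, ∀ b ∈ monomials (j n) n,
      a * b ∈ monomials (k (m + n)) (m + n))
    {a b : BH} (ha : a ∈ closedSpan i) (hb : b ∈ closedSpan j) : a * b ∈ closedSpan k := by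
  refine map_mem_closure₂ continuous_mul ha hb fun x hx y hy => ?_
  have hle : (⨆ n, monomials (i n) n) * (⨆ n, monomials (j n) n) ≤ ⨆ n, monomials (k n) n := by
    rw [Submodule.iSup_mul]
    refine iSup_le fun m => ?_
    rw [Submodule.mul_iSup]
    refine iSup_le fun n => Submodule.mul_le.2 fun a ha b hb => ?_
    exact le_iSup (fun n => monomials (k n) n) (m + n) (h m n a ha b hb)
  exact hle (Submodule.mul_mem_mul hx hy)

theorem star_mem_closedSpan {α : ℝ} {j : ℤ → ClosedIdeal (CstarZ α)}
    (h : ∀ n, ∀ a ∈ monomials (j n) n, star a ∈ monomials (j (-n)) (-n))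
    {a : BH} (ha : a ∈ closedSpan j) : star a ∈ closedSpan j := by
  refine map_mem_closure continuous_star ha fun x hx => ?_
  change x ∈ ⨆ n, monomials (j n) n at hx
  change star x ∈ ⨆ n, monomials (j n) n
  induction hx using Submodule.iSup_induction' with
  | mem n x hx => exact le_iSup (fun n => monomials (j n) n) (-n) (h n x hx)
  | zero => rw [star_zero]; exact zero_mem _
  | add x y _ _ hx hy => rw [star_add]; exact add_mem hx hy

/-- The adjoint has symbol `φ̄ ∘ τ⁻ⁿ`, which vanishes on `τⁿ Z(j n)`. -/
theorem Cif1.star_mem_monomials {α : ℝ} {j : ℤ → ClosedIdeal (CstarZ α)} (h : Cif1 j) (n : ℤ)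
    (a : BH) (ha : a ∈ monomials (j n) n) : star a ∈ monomials (j (-n)) (-n) := by
  obtain ⟨φ, hφ, rfl⟩ := ha
  rw [hat_mem_iff] at hφ
  rw [star_expX_mul_hatOp]
  refine ⟨_, (hat_mem_iff _ _).2 fun t ht => ?_, rfl⟩
  rw [h n, mem_rot_zpow_image] at ht
  rw [shift_apply, ContinuousMap.star_apply, neg_zsmul, ← sub_eq_add_neg, hφ _ ht, star_zero]

theorem eq_zero_of_mem_monomials {α : ℝ} {I : ClosedIdeal (CstarZ α)} (hI : I.ideal = ⊥) {n : ℤ}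
    {a : BH} (ha : a ∈ monomials I n) : a = 0 := by
  obtain ⟨φ, hφ, rfl⟩ := ha
  rw [hI, TwoSidedIdeal.mem_bot] at hφ
  rw [← coe_hat, hφ, ZeroMemClass.coe_zero, mul_zero]

/-- The product has symbol `(ψ ∘ τᵐ) φ`, which vanishes on `τ⁻ᵐ Z(c n) ∪ Z(j m)`. Off the supports a
factor is zero, so restricting `Cif2` to them loses nothing. -/
theorem Cif2.mul_mem_monomials {α : ℝ} {c j : ℤ → ClosedIdeal (CstarZ α)} (h : Cif2 c j) (n m : ℤ)
    (a : BH) (ha : a ∈ monomials (c n) n) (b : BH) (hb : b ∈ monomials (j m) m) :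
    a * b ∈ monomials (j (n + m)) (n + m) := by
  by_cases hn : (c n).ideal = ⊥
  · rw [eq_zero_of_mem_monomials hn ha, zero_mul]
    exact zero_mem _
  by_cases hm : (j m).ideal = ⊥
  · rw [eq_zero_of_mem_monomials hm hb, mul_zero]
    exact zero_mem _
  obtain ⟨ψ, hψ, rfl⟩ := ha
  obtain ⟨φ, hφ, rfl⟩ := hb
  rw [hat_mem_iff] at hφ hψ
  rw [expX_mul_hatOp_mul]
  refine ⟨_, (hat_mem_iff _ _).2 fun t ht => ?_, rfl⟩
  rw [add_comm n m] at ht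
  rw [ContinuousMap.mul_apply, shift_apply]
  rcases h n hn m hm ht with h1 | h1
  · rw [mem_rot_zpow_image, neg_zsmul, sub_neg_eq_add] at h1
    rw [hψ _ h1, zero_mul]
  · rw [hφ _ h1, mul_zero]

/-! ### The intermediate algebra of a closed ideal function -/

theorem mem_Phi_of_mem_generators {α : ℝ} {c : IdealFunction α} {a : BH}
    (ha : a ∈ generators c.1) : a ∈ (Phi c).alg :=
  StarSubalgebra.le_topologicalClosure _ (StarAlgebra.subset_adjoin ℂ _ ha)

/-- For closed `c` the closed span of the monomials is already a unital star algebra, so generating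
adds nothing. -/
theorem mem_Phi_iff {α : ℝ} {c : IdealFunction α} (hc : c.Closed) {a : BH} :
    a ∈ (Phi c).alg ↔ a ∈ closedSpan c.1 := by
  constructor
  · have hone : (1 : BH) ∈ closedSpan c.1 := by
      refine monomials_le_closedSpan c.1 0 ⟨1, ?_, by rw [expX_zero, map_one, mul_one]⟩
      rw [c.2]
      trivial
    let S : StarSubalgebra ℂ BH :=
      { carrier := closedSpan c.1
        mul_mem' := mul_mem_closedSpan (Cif2.mul_mem_monomials hc.2)
        add_mem' := add_mem
        algebraMap_mem' := fun r => by
          rw [Algebra.algebraMap_eq_smul_one]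
          exact (closedSpan c.1).smul_mem r hone
        star_mem' := star_mem_closedSpan (Cif1.star_mem_monomials hc.1) }
    have hle : (Phi c).alg ≤ S := by
      refine StarSubalgebra.topologicalClosure_minimal (StarAlgebra.adjoin_le ?_)
        (Submodule.isClosed_topologicalClosure _)
      rintro _ ⟨n, η, hη, rfl⟩
      exact monomials_le_closedSpan c.1 n (expX_mul_coe_mem_monomials.2 hη)
    exact fun h => hle h
  · have hle : closedSpan c.1 ≤ Subalgebra.toSubmodule (Phi c).alg.toSubalgebra := by
      refine Submodule.topologicalClosure_minimal _ (iSup_le fun n => ?_) (Phi c).isClosed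
      rintro _ ⟨φ, hφ, rfl⟩
      exact mem_Phi_of_mem_generators ⟨n, _, hφ, rfl⟩
    exact fun h => hle h

/-! ### Closed ideals as subspaces of operators -/

/-- A closed ideal of an intermediate algebra, as a subspace of the bounded operators. -/
def idealSubmodule {α : ℝ} {A : IntermediateAlgebra α} (J : ClosedIdeal A.alg) :
    Submodule ℂ BH where
  carrier := (fun a : A.alg => (a : BH)) '' (J.ideal : Set A.alg)
  zero_mem' := ⟨0, J.ideal.zero_mem, rfl⟩
  add_mem' := by
    rintro _ _ ⟨a, ha, rfl⟩ ⟨b, hb, rfl⟩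
    exact ⟨a + b, J.ideal.add_mem ha hb, rfl⟩
  smul_mem' := by
    rintro r _ ⟨a, ha, rfl⟩
    -- Ideals here are ring ideals; scalars act through the multiples of `1 ∈ A`.
    refine ⟨⟨r • 1, A.alg.smul_mem (one_mem _) r⟩ * a, J.ideal.mul_mem_left _ _ ha, ?_⟩
    simp

theorem isClosed_idealSubmodule {α : ℝ} {A : IntermediateAlgebra α} (J : ClosedIdeal A.alg) :
    IsClosed (idealSubmodule J : Set BH) :=
  A.isClosed.isClosedEmbedding_subtypeVal.isClosedMap _ J.isClosed

theorem mem_idealSubmodule {α : ℝ} {A : IntermediateAlgebra α} {J : ClosedIdeal A.alg} {a : BH} :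
    a ∈ idealSubmodule J ↔ ∃ x ∈ J.ideal, (x : BH) = a := Iff.rfl

theorem coe_mem_idealSubmodule {α : ℝ} {A : IntermediateAlgebra α} {J : ClosedIdeal A.alg}
    {a : A.alg} : (a : BH) ∈ idealSubmodule J ↔ a ∈ J.ideal := by
  refine ⟨?_, fun h => ⟨a, h, rfl⟩⟩
  rintro ⟨b, hb, h⟩
  rwa [← Subtype.ext h]

theorem mem_PsiRel_iff {α : ℝ} {A : IntermediateAlgebra α} {J : ClosedIdeal A.alg} {n : ℤ}
    {η : CstarZ α} : η ∈ (PsiRel A J n).ideal ↔ expX n * (η : BH) ∈ idealSubmodule J :=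
  mem_PsiRel A J n η

theorem idealSubmodule_le {α : ℝ} {A : IntermediateAlgebra α} {J : ClosedIdeal A.alg} {a : BH}
    (ha : a ∈ idealSubmodule J) : a ∈ A.alg := by
  obtain ⟨x, -, rfl⟩ := ha
  exact x.2

theorem mul_mem_idealSubmodule_left {α : ℝ} {A : IntermediateAlgebra α} {J : ClosedIdeal A.alg}
    {a b : BH} (ha : a ∈ A.alg) (hb : b ∈ idealSubmodule J) : a * b ∈ idealSubmodule J := by
  obtain ⟨x, hx, rfl⟩ := hb
  exact ⟨⟨a, ha⟩ * x, J.ideal.mul_mem_left _ _ hx, rfl⟩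

theorem mul_mem_idealSubmodule_right {α : ℝ} {A : IntermediateAlgebra α} {J : ClosedIdeal A.alg}
    {a b : BH} (ha : a ∈ idealSubmodule J) (hb : b ∈ A.alg) : a * b ∈ idealSubmodule J := by
  obtain ⟨x, hx, rfl⟩ := ha
  exact ⟨x * ⟨b, hb⟩, J.ideal.mul_mem_right _ _ hx, rfl⟩

theorem twistedAvg_mem_idealSubmodule {α : ℝ} {A : IntermediateAlgebra α} {J : ClosedIdeal A.alg}
    {a : BH} (ha : a ∈ idealSubmodule J) (z : ℂ) (n : ℤ) (K : ℕ) :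
    twistedAvg (conjKoopman α) z n K a ∈ idealSubmodule J := by
  have hU : koopman α ∈ A.alg := A.le_alg (StarAlgebra.elemental.self_mem ℂ _)
  have hpow : ∀ k : ℕ, (conjKoopman α ^ k) a ∈ idealSubmodule J := by
    intro k
    induction k with
    | zero => simpa using ha
    | succ k ih =>
      rw [pow_succ', mul_apply_eq_comp, conjKoopman_apply]
      exact mul_mem_idealSubmodule_right (mul_mem_idealSubmodule_left hU ih) (star_mem hU)
  rw [twistedAvg_apply]
  exact Submodule.smul_mem _ _ (Submodule.sum_mem _ fun k _ => Submodule.smul_mem _ _ (hpow k))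

/-- Closed ideals are invariant under taking Fourier coefficients. -/
theorem HasCoeff.mem_idealSubmodule {α : ℝ} {A : IntermediateAlgebra α} {J : ClosedIdeal A.alg}
    {z : ℂ} {n : ℤ} {a b : BH} (h : HasCoeff (conjKoopman α) z n a b)
    (ha : a ∈ idealSubmodule J) : b ∈ idealSubmodule J :=
  (isClosed_idealSubmodule J).mem_of_tendsto h
    (Filter.Eventually.of_forall fun K => twistedAvg_mem_idealSubmodule ha z n K)

/-! ### The Galois connection -/

variable {α : ℝ} {c : IdealFunction α}

theorem PsiRel_le (hα : Irrational (α / (2 * Real.pi))) (hc : c.Closed)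
    (J : ClosedIdeal (Phi c).alg) : PsiRel (Phi c) J ≤ c.1 := by
  intro n η hη
  exact (expX_mul_coe_mem_closedSpan hα).1
    ((mem_Phi_iff hc).1 (idealSubmodule_le (mem_PsiRel_iff.1 hη)))

theorem PhiRel_le_iff {j : RelIdealFunction c} {J : ClosedIdeal (Phi c).alg} :
    PhiRel c j ≤ J ↔ j.1 ≤ PsiRel (Phi c) J := by
  rw [PhiRel, idealClosure_le_iff, TwoSidedIdeal.span_le]
  constructor
  · intro h n η hη
    have hmem : expX n * (η : BH) ∈ (Phi c).alg :=
      mem_Phi_of_mem_generators ⟨n, η, j.2 n hη, rfl⟩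
    exact mem_PsiRel_iff.2 ⟨⟨_, hmem⟩, h ⟨n, η, hη, rfl⟩, rfl⟩
  · rintro h a ⟨n, η, hη, ha⟩
    have := mem_PsiRel_iff.1 (h n hη)
    rw [← ha] at this
    exact coe_mem_idealSubmodule.1 this

/-- The coefficients of an element of `J` are monomials lying in `J`, hence in `Φ(j)`, and Fejér's
theorem reassembles the element there. The case `j = Ψ(J)` gives perfectness. -/
theorem le_PhiRel_of_PsiRel_le (hα : Irrational (α / (2 * Real.pi))) (hc : c.Closed)
    {j : RelIdealFunction c} {J : ClosedIdeal (Phi c).alg} (h : PsiRel (Phi c) J ≤ j.1) :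
    J ≤ PhiRel c j := by
  intro a ha
  have haJ : (a : BH) ∈ idealSubmodule J := coe_mem_idealSubmodule.2 ha
  have hac : (a : BH) ∈ closedSpan c.1 := (mem_Phi_iff hc).1 a.2
  choose b hb hb' using exists_hasCoeff_of_mem_closedSpan hα hac
  refine coe_mem_idealSubmodule.1 (mem_of_hasCoeff (norm_conjKoopman_le α) (norm_phase α)
    (fun _ => phase_zpow_ne_one hα) ?_ hb' (isClosed_idealSubmodule _) fun n => ?_)
  · exact Submodule.topologicalClosure_mono (iSup_mono fun n => monomials_le_eig _ n) hac
  · have hbJ := (hb' n).mem_idealSubmodule haJ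
    obtain ⟨φ, -, hφ⟩ := hb n
    rw [hφ] at hbJ ⊢
    exact mem_PsiRel_iff.1 (PhiRel_le_iff.1 le_rfl n (h n (mem_PsiRel_iff.2 hbJ)))

/-- The closed ideal of the closed span of the monomials of a closed `c`-ideal function. -/
def closedSpanIdeal (hc : c.Closed) {j : RelIdealFunction c} (hj : j.Closed) :
    ClosedIdeal (Phi c).alg :=
  have hleft : ∀ {x y : (Phi c).alg}, (y : BH) ∈ closedSpan j.1 →
      ((x * y : (Phi c).alg) : BH) ∈ closedSpan j.1 := fun {x _} hy =>
    mul_mem_closedSpan (Cif2.mul_mem_monomials hj.2) ((mem_Phi_iff hc).1 x.2) hy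
  have hstar : ∀ {a : BH}, a ∈ closedSpan j.1 → star a ∈ closedSpan j.1 :=
    star_mem_closedSpan (Cif1.star_mem_monomials hj.1)
  { ideal := TwoSidedIdeal.mk' {a : (Phi c).alg | (a : BH) ∈ closedSpan j.1}
      (closedSpan j.1).zero_mem (fun hx hy => (closedSpan j.1).add_mem hx hy)
      (fun hx => (closedSpan j.1).neg_mem hx) hleft
      -- Right absorption follows from left absorption through `xy = (y* x*)*`.
      (fun {x y} hx => by
        have h := hstar (hleft (x := star y) (y := star x) (hstar hx))
        rwa [← star_mul, StarMemClass.coe_star, star_star] at h)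
    isClosed := by
      rw [TwoSidedIdeal.coe_mk']
      exact (Submodule.isClosed_topologicalClosure _).preimage continuous_subtype_val }

theorem mem_closedSpanIdeal (hc : c.Closed) {j : RelIdealFunction c} (hj : j.Closed)
    {a : (Phi c).alg} : a ∈ (closedSpanIdeal hc hj).ideal ↔ (a : BH) ∈ closedSpan j.1 := by
  rw [closedSpanIdeal, TwoSidedIdeal.mem_mk']
  rfl

/-- The closed span of the monomials of `j` is an ideal containing the generators of `Φ(j)`, and its
only monomials are those of `j`. -/
theorem PsiRel_PhiRel_le (hα : Irrational (α / (2 * Real.pi))) (hc : c.Closed)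
    {j : RelIdealFunction c} (hj : j.Closed) : PsiRel (Phi c) (PhiRel c j) ≤ j.1 := by
  have hle : PhiRel c j ≤ closedSpanIdeal hc hj := by
    rw [PhiRel_le_iff]
    intro n η hη
    refine mem_PsiRel_iff.2 ⟨⟨_, mem_Phi_of_mem_generators ⟨n, η, j.2 n hη, rfl⟩⟩, ?_, rfl⟩
    exact (mem_closedSpanIdeal hc hj).2 ((expX_mul_coe_mem_closedSpan hα).2 hη)
  intro n η hη
  obtain ⟨a, ha, ha'⟩ := (mem_PsiRel _ _ _ _).1 hη
  have := (mem_closedSpanIdeal hc hj).1 (hle ha)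
  rw [ha'] at this
  exact (expX_mul_coe_mem_closedSpan hα).1 this

/-! ### The ideal function of an ideal is closed -/

theorem cif1_PsiRel (A : IntermediateAlgebra α) (J : ClosedIdeal A.alg) : Cif1 (PsiRel A J) := by
  have key : ∀ (n : ℤ) (t : Circ), t ∈ zeroSet (PsiRel A J (-n)) →
      t - n • (α : Circ) ∈ zeroSet (PsiRel A J n) := by
    intro n t ht φ hφ
    have ha : expX n * hatOp α φ ∈ idealSubmodule J := mem_PsiRel_iff.1 hφ
    have hs := star_mem (idealSubmodule_le ha)
    -- For a monomial `a ∈ J` the element `a* a a*` is in `J`, has degree `-n`, and its symbol has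
    -- the zeros of that of `a*`. This avoids proving that `J` is self-adjoint.
    have hJ := mul_mem_idealSubmodule_right (mul_mem_idealSubmodule_left hs ha) hs
    rw [star_expX_mul_hatOp, expX_mul_hatOp_mul, expX_mul_hatOp_mul, neg_add_cancel, zero_add]
      at hJ
    have h0 := ht _ (mem_PsiRel_iff.2 hJ)
    simpa [← sub_eq_add_neg] using h0
  intro n
  ext t
  rw [mem_rot_zpow_image]
  refine ⟨key n t, fun h => ?_⟩
  have h2 := key (-n) (t - n • (α : Circ)) (by rwa [neg_neg])
  rwa [neg_zsmul, sub_neg_eq_add, sub_add_cancel] at h2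

theorem cif2_PsiRel (J : ClosedIdeal (Phi c).alg) : Cif2 c.1 (PsiRel (Phi c) J) := by
  intro n _ m _ t ht
  by_contra hcon
  rw [Set.mem_union, not_or, mem_rot_zpow_image, neg_zsmul, sub_neg_eq_add] at hcon
  obtain ⟨h1, h2⟩ := hcon
  simp only [zeroSet, Set.mem_ofPred_eq, not_forall] at h1 h2
  obtain ⟨ψ, hψ, hψt⟩ := h1
  obtain ⟨φ, hφ, hφt⟩ := h2
  -- The symbol `(ψ ∘ τᵐ) φ` of this product is nonzero at `t`, although the product lies in `J` and
  -- has degree `m + n`.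
  have hJ := mul_mem_idealSubmodule_left
    (mem_Phi_of_mem_generators (c := c) ⟨n, _, hψ, rfl⟩) (mem_PsiRel_iff.1 hφ)
  rw [coe_hat, coe_hat, expX_mul_hatOp_mul, add_comm] at hJ
  have h0 := ht _ (mem_PsiRel_iff.2 hJ)
  rw [ContinuousMap.mul_apply, shift_apply] at h0
  exact (mul_ne_zero hψt hφt) h0

end

end RotationAlgebra

/-! ### Assembly from the Galois connection -/

theorem theorem1p4 (α : ℝ) (hα : Irrational (α / (2 * Real.pi)))
    (c : IdealFunction α) (hc : c.Closed) :
    -- `Ψ_A` takes values in `𝔇_c`, for `A = Φ(c)`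
    ∃ hΨ : ∀ J : ClosedIdeal (Phi c).alg, PsiRel (Phi c) J ≤ c.1,
      -- monotone Galois connection
      GaloisConnection (PhiRel c) (PsiInto c hΨ) ∧
      -- perfect on the ideal side
      (∀ J : ClosedIdeal (Phi c).alg, PhiRel c (PsiInto c hΨ J) = J) ∧
      -- the fixed points are the closed `c`-ideal functions
      (∀ j : RelIdealFunction c, j = PsiInto c hΨ (PhiRel c j) ↔ j.Closed) ∧
      -- `ℭ_c` is stable under the meet and under the closed join
      (∀ j₁ j₂ : ClosedRelIdealFunction c,
        (j₁.1 ⊓ j₂.1).Closed ∧ (PsiInto c hΨ (PhiRel c (j₁.1 ⊔ j₂.1))).Closed) ∧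
      -- `Φ_c` restricts to an isomorphism of lattices from `ℭ_c`, with inverse `Ψ_A`
      ∃ e : ClosedRelIdealFunction c ≃o ClosedIdeal (Phi c).alg,
        (∀ j : ClosedRelIdealFunction c, e j = PhiRel c j.1) ∧
        (∀ J : ClosedIdeal (Phi c).alg, (e.symm J).1 = PsiInto c hΨ J) ∧
        (∀ j₁ j₂ : ClosedRelIdealFunction c,
          PhiRel c (j₁.1 ⊓ j₂.1) = PhiRel c j₁.1 ⊓ PhiRel c j₂.1 ∧
          PhiRel c (PsiInto c hΨ (PhiRel c (j₁.1 ⊔ j₂.1))) =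
            PhiRel c j₁.1 ⊔ PhiRel c j₂.1) := by

  have hΨ := PsiRel_le hα hc
  have gc : GaloisConnection (PhiRel c) (PsiInto c hΨ) := fun _ _ => PhiRel_le_iff
  have perfect : ∀ J, PhiRel c (PsiInto c hΨ J) = J := fun J =>
    le_antisymm (gc.l_u_le J) (le_PhiRel_of_PsiRel_le hα hc le_rfl)
  have closedPsi : ∀ J, (PsiInto c hΨ J).Closed := fun J => ⟨cif1_PsiRel _ J, cif2_PsiRel J⟩
  have fixed : ∀ j : RelIdealFunction c, j = PsiInto c hΨ (PhiRel c j) ↔ j.Closed := fun j =>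
    ⟨fun h => h ▸ closedPsi _, fun h => le_antisymm (gc.le_u_l j) (PsiRel_PhiRel_le hα hc h)⟩
  -- The upper adjoint preserves meets, so a meet of fixed points is again a value of `Ψ`.
  have inf_eq : ∀ j₁ j₂ : ClosedRelIdealFunction c,
      j₁.1 ⊓ j₂.1 = PsiInto c hΨ (PhiRel c j₁.1 ⊓ PhiRel c j₂.1) := fun j₁ j₂ => by
    rw [gc.u_inf, ← (fixed _).2 j₁.2, ← (fixed _).2 j₂.2]
  refine ⟨hΨ, gc, perfect, fixed, fun j₁ j₂ => ⟨inf_eq j₁ j₂ ▸ closedPsi _, closedPsi _⟩,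
    { toFun := fun j => PhiRel c j.1
      invFun := fun J => ⟨PsiInto c hΨ J, closedPsi J⟩
      left_inv := fun j => Subtype.ext ((fixed _).2 j.2).symm
      right_inv := perfect
      map_rel_iff' := fun {j₁ j₂} => by
        change PhiRel c j₁.1 ≤ PhiRel c j₂.1 ↔ j₁.1 ≤ j₂.1
        rw [gc _ _, ← (fixed _).2 j₂.2] },
    fun _ => rfl, fun _ => rfl, fun j₁ j₂ => ⟨by rw [inf_eq, perfect], ?_⟩⟩
  -- Closing up by `ΨΦ` is invisible to `Φ`, and the lower adjoint preserves joins.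
  rw [perfect, gc.l_sup]
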